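/- Let $H$ be an infinite-dimensional complex Hilbert space, viewed as a many-sorted metric structure in continuous first-order logic as follows. For each integer $n\ge 1$ there is a sort $B_n(H)=\{x\in H:\|x\|\le n\}$ with metric $d(x,y)=\|x-y\|$. The function symbols are the inclusions $I_{m,n}:B_m(H)\to B_n(H)$ for $1\le m\le n$; addition and subtraction $+,-:B_n(H)\times B_n(H)\to B_{2n}(H)$; multiplication $r\cdot:B_n(H)\to B_{kn}(H)$ for each $r\in\mathbb{R}$, where $k$ is the natural number with $k-1\le|r|<k$; and multiplication by $i$, $i\cdot:B_n(H)\to B_n(H)$. The predicate symbols are the norm $\|\cdot\|:B_n(H)\to[0,n]$ and $\mathfrak{Re},\mathfrak{Im}:B_n(H)\times B_n(H)\to[-n^2,n^2]$, the real and imaginary parts of the inner product. Formulas are built from atomic ones (the predicates and the metrics applied to terms) by continuous real-valued finitary connectives and by the quantifiers $\sup$ and $\inf$ over sorts. For $A\subseteq H$, a real-valued predicate on a product of sorts is called $A$-definable if it is a uniform limit of interpretations of formulas with parameters from $A$. A function $f:H\to H$ is called $A$-definable if, for each $n\ge 1$, the set $f(B_n(H))$ is bounded and, for every $m\ge 1$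 with $f(B_n(H))\subseteq B_m(H)$, the predicate $(x,y)\mapsto d(f(x),y)$ on $B_n(H)\times B_m(H)$ is $A$-definable. It is called definable if it is $A$-definable for some $A\subseteq H$. Theorem. A bounded linear operator $T:H\to H$ is definable if and only if there exist $\lambda\in\mathbb{C}$ and a compact operator $K:H\to H$ such that $T=\lambda I+K$, where $I$ is the identity operator on $H$. -/

import Mathlib

/-!
Continuous (many-sorted) first-order logic of a complex Hilbert space `H`.  The sorts are indexed
by the integers `n ≥ 1`; sort `n` is interpreted as the closed ball `B_n(H)`, and the metric on each
sort is the norm distance.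
-/

namespace HilbertLogic

/-- The sort `B_n(H) = {x ∈ H : ‖x‖ ≤ n}`, for `n ≥ 1`. -/
abbrev Ball (H : Type*) [NormedAddCommGroup H] (n : ℕ+) : Type _ :=
  {x : H // ‖x‖ ≤ (n : ℝ)}

/-- Terms of the language with parameters from `A`.  `Term A Γ n` is the type of terms of sort `n`
whose variables are among those of the context `Γ`, the list of the sorts of the variables. -/
inductive Term {H : Type*} [NormedAddCommGroup H] (A : Set H) (Γ : List ℕ+) : ℕ+ → Type _
  /-- a variable -/
  | var (i : Fin Γ.length) : Term A Γ (Γ.get i)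
  /-- a parameter `a ∈ A`, named in any sort that contains it -/
  | param (a : H) (ha : a ∈ A) (n : ℕ+) (hn : ‖a‖ ≤ (n : ℝ)) : Term A Γ n
  /-- the inclusion `I_{m,n} : B_m → B_n`, for `m ≤ n` -/
  | incl (m n : ℕ+) (hmn : m ≤ n) (t : Term A Γ m) : Term A Γ n
  /-- addition `B_n × B_n → B_{2n}` -/
  | add (n : ℕ+) (s t : Term A Γ n) : Term A Γ (2 * n)
  /-- subtraction `B_n × B_n → B_{2n}` -/
  | sub (n : ℕ+) (s t : Term A Γ n) : Term A Γ (2 * n)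
  /-- multiplication by the real number `r`, as a map `B_n → B_{kn}` where `k` is the natural number
  with `k - 1 ≤ |r| < k` -/
  | smul (r : ℝ) (n : ℕ+) (t : Term A Γ n) : Term A Γ (Nat.succPNat ⌊|r|⌋₊ * n)
  /-- multiplication by `i`, as a map `B_n → B_n` -/
  | imul (n : ℕ+) (t : Term A Γ n) : Term A Γ n

/-- Formulas of continuous logic over the language with parameters from `A`, with free variables
among those of the context `Γ`. -/
inductive Formula {H : Type*} [NormedAddCommGroup H] (A : Set H) : List ℕ+ → Type _
  /-- the predicate `Re : B_n × B_n → [-n², n²]` -/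
  | re {Γ : List ℕ+} (n : ℕ+) (s t : Term A Γ n) : Formula A Γ
  /-- the predicate `Im : B_n × B_n → [-n², n²]` -/
  | im {Γ : List ℕ+} (n : ℕ+) (s t : Term A Γ n) : Formula A Γ
  /-- the predicate `‖·‖ : B_n → [0, n]` -/
  | norm {Γ : List ℕ+} (n : ℕ+) (t : Term A Γ n) : Formula A Γ
  /-- the metric on the sort `B_n` -/
  | dist {Γ : List ℕ+} (n : ℕ+) (s t : Term A Γ n) : Formula A Γ
  /-- a finitary connective, that is, a continuous real function of finitely many real variables -/
  | conn {Γ : List ℕ+} (k : ℕ) (u : C(Fin k → ℝ, ℝ)) (φ : Fin k → Formula A Γ) : Formula A Γ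
  /-- the quantifier `sup` over a variable of sort `B_n` (the first variable of the context) -/
  | sup {Γ : List ℕ+} (n : ℕ+) (φ : Formula A (n :: Γ)) : Formula A Γ
  /-- the quantifier `inf` over a variable of sort `B_n` (the first variable of the context) -/
  | inf {Γ : List ℕ+} (n : ℕ+) (φ : Formula A (n :: Γ)) : Formula A Γ

/-- Assignments of values to the variables of a context, i.e. the product of the sorts in `Γ`. -/
abbrev Assignment (H : Type*) [NormedAddCommGroup H] (Γ : List ℕ+) : Type _ :=
  (i : Fin Γ.length) → Ball H (Γ.get i)

/-- The assignment that gives the value `a` to the new first variable and agrees with `v`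
on the others. -/
def Assignment.cons {H : Type*} [NormedAddCommGroup H] {Γ : List ℕ+} {n : ℕ+}
    (a : Ball H n) (v : Assignment H Γ) : Assignment H (n :: Γ) :=
  fun i => Fin.cases (motive := fun i => Ball H ((n :: Γ).get i)) a v i

section Semantics

variable {H : Type*} [NormedAddCommGroup H] [InnerProductSpace ℂ H]

/-- The value of a term. -/
noncomputable def Term.eval {A : Set H} {Γ : List ℕ+} (v : Assignment H Γ) :
    {n : ℕ+} → Term A Γ n → Ball H n
  | _, .var i => v i
  | _, .param a _ _ hn => ⟨a, hn⟩
  | _, .incl _ _ hmn t => ⟨(t.eval v).1, (t.eval v).2.trans (by exact_mod_cast hmn)⟩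
  | _, .add n s t => ⟨(s.eval v).1 + (t.eval v).1, by
      have h := norm_add_le (s.eval v).1 (t.eval v).1
      have h₁ := (s.eval v).2
      have h₂ := (t.eval v).2
      push_cast
      linarith⟩
  | _, .sub n s t => ⟨(s.eval v).1 - (t.eval v).1, by
      have h := norm_sub_le (s.eval v).1 (t.eval v).1
      have h₁ := (s.eval v).2
      have h₂ := (t.eval v).2
      push_cast
      linarith⟩
  | _, .smul r n t => ⟨(r : ℂ) • (t.eval v).1, by
      have h₁ := (t.eval v).2
      have h₂ := (Nat.lt_floor_add_one |r|).le
      rw [norm_smul, Complex.norm_real, Real.norm_eq_abs, PNat.mul_coe, Nat.succPNat_coe]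
      push_cast
      gcongr⟩
  | _, .imul n t => ⟨Complex.I • (t.eval v).1, by
      rw [norm_smul, Complex.norm_I, one_mul]
      exact (t.eval v).2⟩

/-- The value of a formula.  The inner product of `x` and `y`, linear in `x`, is
`inner ℂ y x` in Mathlib's convention. -/
noncomputable def Formula.eval {A : Set H} :
    {Γ : List ℕ+} → Formula A Γ → Assignment H Γ → ℝ
  | _, .re _ s t, v => (inner ℂ (t.eval v).1 (s.eval v).1).re
  | _, .im _ s t, v => (inner ℂ (t.eval v).1 (s.eval v).1).im
  | _, .norm _ t, v => ‖(t.eval v).1‖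
  | _, .dist _ s t, v => Dist.dist (s.eval v) (t.eval v)
  | _, .conn _ u φ, v => u fun j => (φ j).eval v
  | _, .sup n φ, v => ⨆ a : Ball H n, φ.eval (Assignment.cons a v)
  | _, .inf n φ, v => ⨅ a : Ball H n, φ.eval (Assignment.cons a v)

/-- Every formula takes values in a bounded interval, so that the suprema and infima in
`Formula.eval` are those of nonempty bounded sets of reals. -/
theorem Formula.exists_abs_eval_le {A : Set H} {Γ : List ℕ+} (φ : Formula A Γ) :
    ∃ C : ℝ, ∀ v : Assignment H Γ, |φ.eval v| ≤ C := by
  induction φ with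
  | re n s t =>
    refine ⟨n * n, fun v => (Complex.abs_re_le_norm _).trans ((norm_inner_le_norm _ _).trans ?_)⟩
    have h₁ := (s.eval v).2
    have h₂ := (t.eval v).2
    gcongr
  | im n s t =>
    refine ⟨n * n, fun v => (Complex.abs_im_le_norm _).trans ((norm_inner_le_norm _ _).trans ?_)⟩
    have h₁ := (s.eval v).2
    have h₂ := (t.eval v).2
    gcongr
  | norm n t =>
    refine ⟨n, fun v => ?_⟩
    simpa [Formula.eval] using (t.eval v).2
  | dist n s t =>
    refine ⟨n + n, fun v => ?_⟩
    have h₁ := (s.eval v).2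
    have h₂ := (t.eval v).2
    simp only [Formula.eval, abs_dist, Subtype.dist_eq]
    exact (dist_le_norm_add_norm _ _).trans (add_le_add h₁ h₂)
  | conn k u φ ih =>
    choose C hC using ih
    have hK : IsCompact (Set.univ.pi fun j => Set.Icc (-C j) (C j)) :=
      isCompact_univ_pi fun j => isCompact_Icc
    obtain ⟨D, hD⟩ := hK.exists_bound_of_continuousOn u.continuous.continuousOn
    exact ⟨D, fun v => hD _ fun j _ => abs_le.1 (hC j v)⟩
  | sup n φ ih =>
    obtain ⟨C, hC⟩ := ih
    have : Nonempty (Ball H n) := ⟨⟨0, by simp⟩⟩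
    refine ⟨C, fun v => abs_le.2 ⟨?_, ciSup_le fun a => (abs_le.1 (hC _)).2⟩⟩
    exact (abs_le.1 (hC (Assignment.cons ⟨0, by simp⟩ v))).1.trans
      (le_ciSup (f := fun a : Ball H n => φ.eval (Assignment.cons a v))
        ⟨C, by rintro _ ⟨a, rfl⟩; exact (abs_le.1 (hC _)).2⟩ _)
  | inf n φ ih =>
    obtain ⟨C, hC⟩ := ih
    have : Nonempty (Ball H n) := ⟨⟨0, by simp⟩⟩
    refine ⟨C, fun v => abs_le.2 ⟨le_ciInf fun a => (abs_le.1 (hC _)).1, ?_⟩⟩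
    exact (ciInf_le (f := fun a : Ball H n => φ.eval (Assignment.cons a v))
      ⟨-C, by rintro _ ⟨a, rfl⟩; exact (abs_le.1 (hC _)).1⟩ ⟨0, by simp⟩).trans
      (abs_le.1 (hC _)).2

/-- A predicate on a product of sorts is `A`-definable if it is a uniform limit of (the
interpretations of) formulas with parameters from `A`. -/
def IsDefinablePredicate (A : Set H) (Γ : List ℕ+) (P : Assignment H Γ → ℝ) : Prop :=
  ∃ φ : ℕ → Formula A Γ, TendstoUniformly (fun k v => (φ k).eval v) P Filter.atTop

/-- A function `f : H → H` is `A`-definable if each `f(B_n)` is bounded and, for all `n, m ≥ 1` with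
`f(B_n) ⊆ B_m`, the predicate `d(f(x), y)` on `B_n × B_m` is `A`-definable. -/
structure IsDefinableOver (A : Set H) (f : H → H) : Prop where
  bounded : ∀ n : ℕ+, Bornology.IsBounded (f '' {x | ‖x‖ ≤ (n : ℝ)})
  definable : ∀ n m : ℕ+, (∀ x : H, ‖x‖ ≤ (n : ℝ) → ‖f x‖ ≤ (m : ℝ)) →
    IsDefinablePredicate A [n, m] fun v =>
      Dist.dist (f (v (0 : Fin 2)).1) (v (1 : Fin 2)).1

/-- A function `f : H → H` is definable if it is `A`-definable for some set `A ⊆ H` of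
parameters. -/
def IsDefinable (f : H → H) : Prop :=
  ∃ A : Set H, IsDefinableOver A f

end Semantics

end HilbertLogic

/-! A formula mentions finitely many parameters, so it is invariant under every unitary `U` that
fixes their span `V` pointwise. If it approximates `d(Tx, y)` uniformly, comparing its values at
`(x, Tx)` and `(Ux, UTx)` shows that `T` almost commutes with `U`
(`IsDefinable.exists_norm_commutator_le`). Reflections along vectors of `Vᗮ` are such unitaries. The
one sending a unit vector `x` to `-x` forces `Tx` to be nearly `c x`; those exchanging `x` with
another unit vector `y` carry the same scalar `c` to `y` (`exists_norm_sub_smul_le`). As the error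
tends to 0 the scalars converge to some `l`, and `T - l` is a norm limit of finite-rank operators.

Conversely, a compact `K` is uniformly close on each ball to `P_V K` with `V` finite-dimensional.
The square of `‖l x + P_V K x - y‖` expands into inner products of `x`, `y` and parameters, so this
norm is the value of a quantifier-free formula. -/

namespace HilbertLogic

/-! ### Unitary invariance of formulas and almost commutation -/

section Invariance

variable {H : Type*} [NormedAddCommGroup H] [InnerProductSpace ℂ H]

/-- The action of a unitary operator on a sort. -/
def Ball.mapEquiv (U : H ≃ₗᵢ[ℂ] H) (n : ℕ+) : Ball H n ≃ Ball H n where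
  toFun x := ⟨U x.1, by simpa using x.2⟩
  invFun x := ⟨U.symm x.1, by simpa using x.2⟩
  left_inv x := by simp
  right_inv x := by simp

/-- The action of a unitary operator on assignments. -/
def Assignment.map (U : H ≃ₗᵢ[ℂ] H) {Γ : List ℕ+} (v : Assignment H Γ) : Assignment H Γ :=
  fun i => Ball.mapEquiv U _ (v i)

theorem Assignment.map_cons (U : H ≃ₗᵢ[ℂ] H) {Γ : List ℕ+} {n : ℕ+} (a : Ball H n)
    (v : Assignment H Γ) :
    (Assignment.cons a v).map U = Assignment.cons (Ball.mapEquiv U n a) (v.map U) := by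
  funext i
  refine Fin.cases ?_ (fun j => ?_) i <;> rfl

/-- The value of a term is equivariant under the unitary operators that fix its parameters. -/
theorem Term.exists_finite_eval_map {A : Set H} {Γ : List ℕ+} {n : ℕ+} (t : Term A Γ n) :
    ∃ F : Set H, F.Finite ∧ ∀ U : H ≃ₗᵢ[ℂ] H, (∀ a ∈ F, U a = a) →
      ∀ v : Assignment H Γ, (t.eval (v.map U)).1 = U (t.eval v).1 := by
  induction t with
  | var i => exact ⟨∅, Set.finite_empty, fun U _ v => rfl⟩
  | param a ha n hn => exact ⟨{a}, Set.finite_singleton a, fun U hU v => (hU a rfl).symm⟩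
  | incl m n hmn t ih => exact ih
  | add n s t ihs iht =>
    obtain ⟨F, hF, hs⟩ := ihs
    obtain ⟨G, hG, ht⟩ := iht
    refine ⟨F ∪ G, hF.union hG, fun U hU v => ?_⟩
    simp only [Term.eval, map_add, hs U (fun a ha => hU a (.inl ha)) v,
      ht U (fun a ha => hU a (.inr ha)) v]
  | sub n s t ihs iht =>
    obtain ⟨F, hF, hs⟩ := ihs
    obtain ⟨G, hG, ht⟩ := iht
    refine ⟨F ∪ G, hF.union hG, fun U hU v => ?_⟩
    simp only [Term.eval, map_sub, hs U (fun a ha => hU a (.inl ha)) v,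
      ht U (fun a ha => hU a (.inr ha)) v]
  | smul r n t ih =>
    obtain ⟨F, hF, h⟩ := ih
    exact ⟨F, hF, fun U hU v => by simp only [Term.eval, map_smul, h U hU v]⟩
  | imul n t ih =>
    obtain ⟨F, hF, h⟩ := ih
    exact ⟨F, hF, fun U hU v => by simp only [Term.eval, map_smul, h U hU v]⟩

/-- The value of a formula is invariant under the unitary operators that fix its parameters. -/
theorem Formula.exists_finite_eval_map {A : Set H} {Γ : List ℕ+} (φ : Formula A Γ) :
    ∃ F : Set H, F.Finite ∧ ∀ U : H ≃ₗᵢ[ℂ] H, (∀ a ∈ F, U a = a) →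
      ∀ v : Assignment H Γ, φ.eval (v.map U) = φ.eval v := by
  induction φ with
  | re n s t | im n s t | dist n s t =>
    obtain ⟨F, hF, hs⟩ := s.exists_finite_eval_map
    obtain ⟨G, hG, ht⟩ := t.exists_finite_eval_map
    refine ⟨F ∪ G, hF.union hG, fun U hU v => ?_⟩
    simp only [Formula.eval, Subtype.dist_eq, hs U (fun a ha => hU a (.inl ha)) v,
      ht U (fun a ha => hU a (.inr ha)) v, LinearIsometryEquiv.inner_map_map,
      LinearIsometryEquiv.dist_map]
  | norm n t =>
    obtain ⟨F, hF, h⟩ := t.exists_finite_eval_map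
    exact ⟨F, hF, fun U hU v => by simp only [Formula.eval, h U hU v, LinearIsometryEquiv.norm_map]⟩
  | conn k u φ ih =>
    choose F hF h using ih
    refine ⟨⋃ j, F j, Set.finite_iUnion hF, fun U hU v => ?_⟩
    simp only [Formula.eval]
    congr 1
    funext j
    exact h j U (fun a ha => hU a (Set.mem_iUnion_of_mem j ha)) v
  | sup n φ ih =>
    obtain ⟨F, hF, h⟩ := ih
    refine ⟨F, hF, fun U hU v => ?_⟩
    -- `U` permutes the ball quantified over, so the supremum is merely reindexed.
    exact ((Ball.mapEquiv U n).iSup_congr fun a => by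
      rw [← Assignment.map_cons, h U hU]).symm
  | inf n φ ih =>
    obtain ⟨F, hF, h⟩ := ih
    refine ⟨F, hF, fun U hU v => ?_⟩
    exact ((Ball.mapEquiv U n).iInf_congr fun a => by
      rw [← Assignment.map_cons, h U hU]).symm

/-- A definable operator almost commutes with the unitary operators that fix a suitable
finite-dimensional subspace pointwise. -/
theorem IsDefinable.exists_norm_commutator_le {T : H →L[ℂ] H} (hT : IsDefinable (T : H → H))
    {ε : ℝ} (hε : 0 < ε) :
    ∃ V : Submodule ℂ H, FiniteDimensional ℂ V ∧ ∀ U : H ≃ₗᵢ[ℂ] H, (∀ a ∈ V, U a = a) →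
      ∀ x : H, ‖x‖ ≤ 1 → ‖T (U x) - U (T x)‖ ≤ ε := by
  obtain ⟨A, hA⟩ := hT
  obtain ⟨m, hm⟩ : ∃ m : ℕ+, ‖T‖ ≤ m := by
    obtain ⟨k, hk⟩ := exists_nat_ge ‖T‖
    exact ⟨k.succPNat, hk.trans (by simp)⟩
  have hTm : ∀ x : H, ‖x‖ ≤ ((1 : ℕ+) : ℝ) → ‖T x‖ ≤ (m : ℝ) := fun x hx =>
    ((T.le_opNorm_of_le hx).trans (by simp)).trans hm
  obtain ⟨φ, hφ⟩ := hA.definable 1 m hTm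
  obtain ⟨k, hk⟩ := (Metric.tendstoUniformly_iff.1 hφ (ε / 2) (half_pos hε)).exists
  obtain ⟨F, hF, hinv⟩ := (φ k).exists_finite_eval_map
  refine ⟨Submodule.span ℂ F, FiniteDimensional.span_of_finite ℂ hF, fun U hU x hx => ?_⟩
  -- On the graph point `(x, Tx)` the predicate vanishes; at its image under `U` it equals the
  -- commutator norm. Each is within `ε / 2` of the same formula value.
  let v : Assignment H [1, m] :=
    Assignment.cons (⟨x, by simpa using hx⟩ : Ball H 1)
      (Assignment.cons (⟨T x, hTm x (by simpa using hx)⟩ : Ball H m) fun i => i.elim0)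
  have h₁ := hk v
  have h₂ := hk (v.map U)
  rw [hinv U (fun a ha => hU a (Submodule.subset_span ha)) v] at h₂
  have e₁ : dist (T (v (0 : Fin 2)).1) (v (1 : Fin 2)).1 = 0 := dist_self (T x)
  have e₂ : dist (T (v.map U (0 : Fin 2)).1) (v.map U (1 : Fin 2)).1
    = ‖T (U x) - U (T x)‖ := dist_eq_norm (T (U x)) (U (T x))
  rw [e₁, Real.dist_eq] at h₁
  rw [e₂, Real.dist_eq] at h₂
  have := abs_lt.1 h₁
  have := abs_lt.1 h₂
  linarith

end Invariance

end HilbertLogic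

namespace HilbertLogic

/-! ### From almost commutation to scalar plus compact -/

section ScalarPlusCompact

variable {H : Type*} [NormedAddCommGroup H] [InnerProductSpace ℂ H]

/-- The orthogonal complement of a finite-dimensional subspace contains a unit vector. -/
theorem exists_norm_eq_one_mem_orthogonal (hH : ¬ FiniteDimensional ℂ H) (V : Submodule ℂ H)
    [FiniteDimensional ℂ V] : ∃ x ∈ Vᗮ, ‖x‖ = 1 := by
  have hV : Vᗮ ≠ ⊥ := fun h => hH <| by
    rw [Submodule.orthogonal_eq_bot_iff] at h
    exact Module.Finite.equiv ((LinearEquiv.ofEq V ⊤ h).trans Submodule.topEquiv)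
  obtain ⟨z, hz, hz0⟩ := Submodule.exists_mem_ne_zero_of_ne_bot hV
  exact ⟨((‖z‖⁻¹ : ℝ) : ℂ) • z, Vᗮ.smul_mem _ hz, by simp [norm_smul, hz0]⟩

/-- An operator that almost commutes with the unitary operators fixing a finite-dimensional
subspace pointwise is close to a scalar on the complement of such a subspace. -/
theorem exists_norm_sub_smul_le (hH : ¬ FiniteDimensional ℂ H) (T : H →L[ℂ] H) {ε : ℝ}
    (V : Submodule ℂ H) [FiniteDimensional ℂ V]
    (hV : ∀ U : H ≃ₗᵢ[ℂ] H, (∀ a ∈ V, U a = a) → ∀ x : H, ‖x‖ ≤ 1 → ‖T (U x) - U (T x)‖ ≤ ε) :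
    ∃ (W : Submodule ℂ H) (c : ℂ), FiniteDimensional ℂ W ∧
      ∀ y ∈ Wᗮ, ‖T y - c • y‖ ≤ 2 * ε * ‖y‖ := by
  have hrefl : ∀ z v : H, (ℂ ∙ z)ᗮ.reflection v
      = v - (2 * (inner ℂ z v / (‖z‖ : ℂ) ^ 2)) • z := fun z v => by
    rw [Submodule.reflection_orthogonal_apply, Submodule.reflection_singleton_apply, two_smul,
      mul_smul, two_smul, neg_sub]
    rfl
  have hfix : ∀ z ∈ Vᗮ, ∀ a ∈ V, (ℂ ∙ z)ᗮ.reflection a = a := fun z hz a ha => by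
    rw [hrefl, Submodule.inner_left_of_mem_orthogonal ha hz]
    simp
  obtain ⟨x, hx, hx1⟩ := exists_norm_eq_one_mem_orthogonal hH V
  have hxx : inner ℂ x x = (1 : ℂ) := by simp [inner_self_eq_norm_sq_to_K, hx1]
  -- the reflection in the hyperplane orthogonal to `x`
  have hTx : ‖T x - (inner ℂ x (T x) : ℂ) • x‖ ≤ ε / 2 := by
    have h := hV _ (hfix x hx) x hx1.le
    -- The reflection negates `x`, so the commutator at `x` is `-2` times the component of `Tx`
    -- orthogonal to `x`.
    have e : T ((ℂ ∙ x)ᗮ.reflection x) - (ℂ ∙ x)ᗮ.reflection (T x)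
        = (-2 : ℂ) • (T x - (inner ℂ x (T x) : ℂ) • x) := by
      rw [Submodule.reflection_orthogonalComplement_singleton_eq_neg, hrefl, hx1, map_neg]
      simp only [Complex.ofReal_one, one_pow, div_one]
      module
    rw [e, norm_smul] at h
    norm_num at h
    linarith
  set c : ℂ := inner ℂ x (T x)
  refine ⟨V ⊔ (ℂ ∙ x), c, inferInstance, ?_⟩
  have key : ∀ y ∈ (V ⊔ (ℂ ∙ x))ᗮ, ‖y‖ = 1 → ‖T y - c • y‖ ≤ 2 * ε := by
    intro y hy hy1
    have hyV : y ∈ Vᗮ := Submodule.orthogonal_le le_sup_left hy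
    have hxy : inner ℂ x y = (0 : ℂ) := Submodule.inner_right_of_mem_orthogonal
      (le_sup_right (a := V) (Submodule.mem_span_singleton_self x)) hy
    have hyx : inner ℂ y x = (0 : ℂ) := inner_eq_zero_symm.1 hxy
    have hyy : inner ℂ y y = (1 : ℂ) := by simp [inner_self_eq_norm_sq_to_K, hy1]
    -- the reflection that exchanges `x` and `y`
    set U := (ℂ ∙ (x - y))ᗮ.reflection with hU
    have hUx : U x = y := by
      have hn : (‖x - y‖ : ℂ) ^ 2 = 2 := by
        have h := inner_self_eq_norm_sq_to_K (𝕜 := ℂ) (x - y)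
        simp only [inner_sub_left, inner_sub_right, hxx, hxy, hyx, hyy] at h
        rw [show ((‖x - y‖ : ℂ)) = ((RCLike.ofReal ‖x - y‖ : ℂ)) from rfl, ← h]
        norm_num
      rw [hU, hrefl, hn, inner_sub_left, hxx, hyx]
      norm_num
    have h := hV U (hfix _ (Vᗮ.sub_mem hx hyV)) x hx1.le
    -- The two terms contribute at most `ε` and `ε / 2`; the bound `2 * ε` leaves slack.
    have e : T y - c • y = (T (U x) - U (T x)) + U (T x - c • x) := by
      rw [map_sub, map_smul, hUx]
      abel
    rw [e]
    refine (norm_add_le _ _).trans ?_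
    rw [LinearIsometryEquiv.norm_map]
    have := (norm_nonneg _).trans hTx
    linarith
  intro y hy
  rcases eq_or_ne y 0 with rfl | hy0
  · simp
  have hn : (‖y‖ : ℂ) ≠ 0 := by simpa using hy0
  have h := key _ (Submodule.smul_mem _ ((‖y‖⁻¹ : ℝ) : ℂ) hy) (by simp [norm_smul, hy0])
  have e : T y - c • y = (‖y‖ : ℂ) • (T (((‖y‖⁻¹ : ℝ) : ℂ) • y) - c • ((‖y‖⁻¹ : ℝ) : ℂ) • y) := by
    rw [map_smul, smul_comm c, ← smul_sub, smul_smul, Complex.ofReal_inv, mul_inv_cancel₀ hn,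
      one_smul]
  rw [e, norm_smul, Complex.norm_real, norm_norm, mul_comm]
  gcongr

/-- An operator that is arbitrarily small on the complements of finite-dimensional subspaces is
compact. -/
theorem isCompactOperator_of_norm_le_on_orthogonal [CompleteSpace H] (T : H →L[ℂ] H)
    (h : ∀ ε : ℝ, 0 < ε → ∃ W : Submodule ℂ H, FiniteDimensional ℂ W ∧
      ∀ y ∈ Wᗮ, ‖T y‖ ≤ ε * ‖y‖) : IsCompactOperator T := by
  have hmem : T ∈ closure {S : H →L[ℂ] H | IsCompactOperator S} := by
    refine Metric.mem_closure_iff.2 fun ε hε => ?_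
    obtain ⟨W, hW, hT⟩ := h (ε / 2) (half_pos hε)
    -- This finite-rank operator differs from `T` by `T` composed with the projection onto `Wᗮ`,
    -- where `T` is small.
    refine ⟨T ∘L W.starProjection, ?_, ?_⟩
    · have : IsCompactOperator (W.orthogonalProjectionOnto : H → W) :=
        have := FiniteDimensional.proper ℂ W
        isCompactOperator_of_locallyCompactSpace_dom W.orthogonalProjectionOnto
      exact this.clm_comp (T ∘L W.subtypeL)
    · rw [dist_eq_norm]
      refine (ContinuousLinearMap.opNorm_le_bound _ (half_pos hε).le fun x => ?_).trans_lt
        (half_lt_self hε)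
      have e : (T - T ∘L W.starProjection) x = T (Wᗮ.starProjection x) := by
        rw [Submodule.starProjection_orthogonal_val]
        simp
      rw [e]
      refine (hT _ (Submodule.coe_mem _)).trans ?_
      exact mul_le_mul_of_nonneg_left (Wᗮ.norm_starProjection_apply_le x) (half_pos hε).le
  rwa [isClosed_setOfPred_isCompactOperator.closure_eq] at hmem

/-- An operator that is arbitrarily close to scalars on the complements of finite-dimensional
subspaces is the sum of a scalar and a compact operator. -/
theorem exists_eq_smul_id_add_compact [CompleteSpace H] (hH : ¬ FiniteDimensional ℂ H)
    (T : H →L[ℂ] H)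
    (h : ∀ ε : ℝ, 0 < ε → ∃ (W : Submodule ℂ H) (c : ℂ), FiniteDimensional ℂ W ∧
      ∀ y ∈ Wᗮ, ‖T y - c • y‖ ≤ ε * ‖y‖) :
    ∃ (c : ℂ) (K : H →L[ℂ] H), IsCompactOperator K ∧ T = c • ContinuousLinearMap.id ℂ H + K := by
  have hpos : ∀ k : ℕ, (0 : ℝ) < 1 / (k + 1) := fun k => Nat.one_div_pos_of_nat
  choose W c hW hc using fun k : ℕ => h _ (hpos k)
  have hdist : ∀ j k, dist (c j) (c k) ≤ 1 / (j + 1) + 1 / (k + 1) := fun j k => by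
    -- On a unit vector orthogonal to both subspaces, `T` is close to both scalars at once.
    obtain ⟨y, hy, hy1⟩ := exists_norm_eq_one_mem_orthogonal hH (W j ⊔ W k)
    have hj := hc j y (Submodule.orthogonal_le le_sup_left hy)
    have hk := hc k y (Submodule.orthogonal_le le_sup_right hy)
    rw [hy1, mul_one] at hj hk
    have e : (c j - c k) • y = (T y - c k • y) - (T y - c j • y) := by module
    calc dist (c j) (c k) = ‖(c j - c k) • y‖ := by rw [norm_smul, hy1, mul_one, dist_eq_norm]
      _ ≤ ‖T y - c k • y‖ + ‖T y - c j • y‖ := e ▸ norm_sub_le _ _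
      _ ≤ _ := by linarith
  have hlim := tendsto_one_div_add_atTop_nhds_zero_nat (𝕜 := ℝ)
  obtain ⟨l, hl⟩ : ∃ l, Filter.Tendsto c Filter.atTop (nhds l) := by
    refine cauchySeq_tendsto_of_complete (cauchySeq_of_le_tendsto_0
      (fun N : ℕ => (1 / (N + 1) + 1 / (N + 1) : ℝ)) (fun j k N hj hk => (hdist j k).trans ?_) ?_)
    · exact add_le_add (Nat.one_div_le_one_div hj) (Nat.one_div_le_one_div hk)
    · simpa using hlim.add hlim
  refine ⟨l, T - l • ContinuousLinearMap.id ℂ H, ?_, by abel⟩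
  refine isCompactOperator_of_norm_le_on_orthogonal _ fun ε hε => ?_
  obtain ⟨k, hk, hlk⟩ := ((hlim.eventually_lt_const (half_pos hε)).and
    (Metric.tendsto_nhds.1 hl (ε / 2) (half_pos hε))).exists
  refine ⟨W k, hW k, fun y hy => ?_⟩
  have e : (T - l • ContinuousLinearMap.id ℂ H) y = (T y - c k • y) + (c k - l) • y := by
    simp only [sub_apply, smul_apply,
      ContinuousLinearMap.id_apply]
    module
  rw [e]
  refine (norm_add_le _ _).trans ?_
  rw [norm_smul, ← dist_eq_norm (c k)]
  have h₁ := hc k y hy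
  have h₂ : 1 / ((k : ℝ) + 1) * ‖y‖ ≤ ε / 2 * ‖y‖ := by gcongr
  have h₃ : dist (c k) l * ‖y‖ ≤ ε / 2 * ‖y‖ := by gcongr
  linarith

end ScalarPlusCompact

end HilbertLogic

namespace HilbertLogic

/-! ### Quantifier-free formulas defining scalar plus compact -/

section QuantifierFree

variable {H : Type*} [NormedAddCommGroup H] [InnerProductSpace ℂ H]

/-- The real-valued functions given by a single formula, with arbitrary parameters. -/
def IsFormulaValue (Γ : List ℕ+) (g : Assignment H Γ → ℝ) : Prop :=
  ∃ φ : Formula (Set.univ : Set H) Γ, ∀ v, φ.eval v = g v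

/-- The vector-valued functions given by a single term, with arbitrary parameters. -/
def IsTermValue (Γ : List ℕ+) (p : Assignment H Γ → H) : Prop :=
  ∃ (n : ℕ+) (t : Term (Set.univ : Set H) Γ n), ∀ v, (t.eval v).1 = p v

/-- The complex-valued functions whose real and imaginary parts are given by formulas. -/
def IsComplexFormulaValue (Γ : List ℕ+) (g : Assignment H Γ → ℂ) : Prop :=
  IsFormulaValue Γ (fun v => (g v).re) ∧ IsFormulaValue Γ (fun v => (g v).im)

variable {Γ : List ℕ+}

theorem IsFormulaValue.comp {k : ℕ} {g : Fin k → Assignment H Γ → ℝ}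
    (hg : ∀ j, IsFormulaValue Γ (g j)) {u : (Fin k → ℝ) → ℝ} (hu : Continuous u) :
    IsFormulaValue Γ fun v => u fun j => g j v := by
  choose φ hφ using hg
  refine ⟨.conn k ⟨u, hu⟩ φ, fun v => ?_⟩
  simp only [Formula.eval, hφ, ContinuousMap.coe_mk]

theorem IsFormulaValue.comp₁ {g : Assignment H Γ → ℝ} (hg : IsFormulaValue Γ g) {u : ℝ → ℝ}
    (hu : Continuous u) : IsFormulaValue Γ fun v => u (g v) :=
  IsFormulaValue.comp (k := 1) (g := fun _ => g) (fun _ => hg) (u := fun x => u (x 0)) (by fun_prop)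

theorem IsFormulaValue.comp₂ {g h : Assignment H Γ → ℝ} (hg : IsFormulaValue Γ g)
    (hh : IsFormulaValue Γ h) {u : ℝ → ℝ → ℝ} (hu : Continuous fun x : Fin 2 → ℝ => u (x 0) (x 1)) :
    IsFormulaValue Γ fun v => u (g v) (h v) :=
  IsFormulaValue.comp (k := 2) (g := ![g, h]) (fun j => by fin_cases j; exacts [hg, hh]) hu

theorem IsFormulaValue.const (c : ℝ) : IsFormulaValue (H := H) Γ fun _ => c :=
  IsFormulaValue.comp (k := 0) (g := fun j => j.elim0) (fun j => j.elim0) (u := fun _ => c)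
    continuous_const

theorem IsFormulaValue.add {g h : Assignment H Γ → ℝ} (hg : IsFormulaValue Γ g)
    (hh : IsFormulaValue Γ h) : IsFormulaValue Γ fun v => g v + h v :=
  hg.comp₂ hh (u := fun a b => a + b) (by fun_prop)

theorem IsFormulaValue.sub {g h : Assignment H Γ → ℝ} (hg : IsFormulaValue Γ g)
    (hh : IsFormulaValue Γ h) : IsFormulaValue Γ fun v => g v - h v :=
  hg.comp₂ hh (u := fun a b => a - b) (by fun_prop)

theorem IsFormulaValue.mul {g h : Assignment H Γ → ℝ} (hg : IsFormulaValue Γ g)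
    (hh : IsFormulaValue Γ h) : IsFormulaValue Γ fun v => g v * h v :=
  hg.comp₂ hh (u := fun a b => a * b) (by fun_prop)

theorem IsComplexFormulaValue.const (c : ℂ) : IsComplexFormulaValue (H := H) Γ fun _ => c :=
  ⟨.const _, .const _⟩

theorem IsComplexFormulaValue.add {g h : Assignment H Γ → ℂ} (hg : IsComplexFormulaValue Γ g)
    (hh : IsComplexFormulaValue Γ h) : IsComplexFormulaValue Γ fun v => g v + h v :=
  ⟨hg.1.add hh.1, hg.2.add hh.2⟩

theorem IsComplexFormulaValue.mul {g h : Assignment H Γ → ℂ} (hg : IsComplexFormulaValue Γ g)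
    (hh : IsComplexFormulaValue Γ h) : IsComplexFormulaValue Γ fun v => g v * h v :=
  ⟨(hg.1.mul hh.1).sub (hg.2.mul hh.2), (hg.1.mul hh.2).add (hg.2.mul hh.1)⟩

theorem IsComplexFormulaValue.conj {g : Assignment H Γ → ℂ} (hg : IsComplexFormulaValue Γ g) :
    IsComplexFormulaValue Γ fun v => starRingEnd ℂ (g v) :=
  ⟨hg.1, hg.2.comp₁ continuous_neg⟩

theorem IsComplexFormulaValue.sum {ι : Type*} (s : Finset ι) {g : ι → Assignment H Γ → ℂ}
    (hg : ∀ i, IsComplexFormulaValue Γ (g i)) :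
    IsComplexFormulaValue Γ fun v => ∑ i ∈ s, g i v := by
  classical
  induction s using Finset.induction_on with
  | empty => simpa using IsComplexFormulaValue.const 0
  | insert i s hi ih => simpa only [Finset.sum_insert hi] using (hg i).add ih

theorem IsTermValue.const (a : H) : IsTermValue Γ fun _ => a := by
  obtain ⟨k, hk⟩ := exists_nat_ge ‖a‖
  exact ⟨k.succPNat, .param a (Set.mem_univ a) _ (hk.trans (by simp)), fun v => rfl⟩

theorem IsTermValue.var (i : Fin Γ.length) : IsTermValue (H := H) Γ fun v => (v i).1 :=
  ⟨_, .var i, fun _ => rfl⟩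

theorem IsTermValue.inner {p q : Assignment H Γ → H} (hp : IsTermValue Γ p)
    (hq : IsTermValue Γ q) : IsComplexFormulaValue Γ fun v => inner ℂ (p v) (q v) := by
  obtain ⟨n, s, hs⟩ := hp
  obtain ⟨m, t, ht⟩ := hq
  -- Inclusions bring both terms to a common sort; they are swapped because the predicates are
  -- linear in their first argument.
  refine ⟨⟨.re (n ⊔ m) (.incl m _ le_sup_right t) (.incl n _ le_sup_left s), fun v => ?_⟩,
    ⟨.im (n ⊔ m) (.incl m _ le_sup_right t) (.incl n _ le_sup_left s), fun v => ?_⟩⟩ <;>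
  simp only [Formula.eval, Term.eval, hs, ht]

/-- The norm of a linear combination of terms, with coefficients given by formulas, is given by
a formula. -/
theorem IsFormulaValue.norm_sum_smul {ι : Type*} [Fintype ι] {c : ι → Assignment H Γ → ℂ}
    {p : ι → Assignment H Γ → H} (hc : ∀ i, IsComplexFormulaValue Γ (c i))
    (hp : ∀ i, IsTermValue Γ (p i)) : IsFormulaValue Γ fun v => ‖∑ i, c i v • p i v‖ := by
  -- The coefficients vary with `v`, so the combination need not be a term; its squared norm is
  -- still a double sum of products of formula values.
  have h := IsComplexFormulaValue.sum Finset.univ fun i =>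
    IsComplexFormulaValue.sum Finset.univ fun j =>
      (hc i).conj.mul ((hc j).mul ((hp i).inner (hp j)))
  convert h.1.comp₁ Real.continuous_sqrt using 2 with v
  rw [norm_eq_sqrt_re_inner (𝕜 := ℂ), sum_inner]
  simp only [inner_sum, inner_smul_left, inner_smul_right]
  simp only [mul_left_comm, RCLike.re_to_complex]

/-- A compact operator is uniformly approximated on a ball by its compressions to
finite-dimensional subspaces. -/
theorem exists_norm_sub_starProjection_lt {K : H →L[ℂ] H} (hK : IsCompactOperator K) (r : ℝ)
    {ε : ℝ} (hε : 0 < ε) : ∃ (V : Submodule ℂ H) (_ : FiniteDimensional ℂ V),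
      ∀ x, ‖x‖ ≤ r → ‖K x - V.starProjection (K x)‖ < ε := by
  have hc : IsCompact (closure (K '' Metric.closedBall 0 r)) :=
    IsCompactOperator.isCompact_closure_image_closedBall (f := (K : H →ₗ[ℂ] H)) hK r
  obtain ⟨t, ht, hcov⟩ := Metric.totallyBounded_iff.1 hc.totallyBounded ε hε
  have : FiniteDimensional ℂ (Submodule.span ℂ t) := FiniteDimensional.span_of_finite ℂ ht
  refine ⟨Submodule.span ℂ t, this, fun x hx => ?_⟩
  have hx' : K x ∈ closure (K '' Metric.closedBall 0 r) :=
    subset_closure ⟨x, by simpa using hx, rfl⟩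
  obtain ⟨y, hy, hxy⟩ := Set.mem_iUnion₂.1 (hcov hx')
  -- The projection is the nearest point of the span, hence at least as close as the net point `y`.
  rw [Submodule.starProjection_minimal]
  refine (ciInf_le ⟨0, by rintro _ ⟨z, rfl⟩; positivity⟩
    (⟨y, Submodule.subset_span hy⟩ : Submodule.span ℂ t)).trans_lt ?_
  simpa [dist_eq_norm] using hxy

/-- The sum of a scalar and a compact operator is definable. -/
theorem isDefinable_smul_id_add [CompleteSpace H] (l : ℂ) {K : H →L[ℂ] H}
    (hK : IsCompactOperator K) :
    IsDefinable ((l • ContinuousLinearMap.id ℂ H + K : H →L[ℂ] H) : H → H) := by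
  refine ⟨Set.univ, fun n => ?_, fun n m _ => ?_⟩
  · have hb : Bornology.IsBounded {x : H | ‖x‖ ≤ (n : ℝ)} :=
      isBounded_iff_forall_norm_le.2 ⟨n, fun x hx => hx⟩
    exact (l • ContinuousLinearMap.id ℂ H + K : H →L[ℂ] H).lipschitz.isBounded_image hb
  have happrox : ∀ k : ℕ, ∃ φ : Formula (Set.univ : Set H) [n, m], ∀ v : Assignment H [n, m],
      dist (dist ((l • ContinuousLinearMap.id ℂ H + K : H →L[ℂ] H) (v (0 : Fin 2)).1)
        (v (1 : Fin 2)).1) (φ.eval v) < 1 / ((k : ℝ) + 1) := by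
    intro k
    obtain ⟨V, hV, hKV⟩ := exists_norm_sub_starProjection_lt hK n
      (ε := 1 / ((k : ℝ) + 1)) Nat.one_div_pos_of_nat
    let b := stdOrthonormalBasis ℂ V
    let x : Assignment H [n, m] → H := fun v => (v (0 : Fin 2)).1
    let y : Assignment H [n, m] → H := fun v => (v (1 : Fin 2)).1
    have hx : IsTermValue [n, m] x := IsTermValue.var (Γ := [n, m]) (0 : Fin 2)
    have hy : IsTermValue [n, m] y := IsTermValue.var (Γ := [n, m]) (1 : Fin 2)
    -- The two extra indices carry `l x` and `-y`. Passing to the adjoint turns the coefficient `⟨b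
    -- j, K x⟩` into an inner product of `x` with a parameter.
    obtain ⟨φ, hφ⟩ := IsFormulaValue.norm_sum_smul (Γ := [n, m])
      (ι := Option (Option (Fin (Module.finrank ℂ V))))
      (c := fun i => i.elim (fun _ => l) fun j => j.elim (fun _ => -1) fun j v =>
        inner ℂ (K.adjoint (b j)) (x v))
      (p := fun i => i.elim x fun j => j.elim y fun j _ => (b j : H))
      (by
        rintro (_ | _ | j)
        exacts [.const l, .const (-1), (IsTermValue.const _).inner hx])
      (by
        rintro (_ | _ | j)
        exacts [hx, hy, IsTermValue.const _])
    refine ⟨φ, fun v => ?_⟩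
    have e : φ.eval v = ‖l • x v + V.starProjection (K (x v)) - y v‖ := by
      rw [hφ, OrthonormalBasis.starProjection_eq_sum_rankOne b]
      simp only [Fintype.sum_option, Option.elim, ContinuousLinearMap.adjoint_inner_left, sum_apply,
        InnerProductSpace.rankOne_apply]
      congr 1
      module
    rw [e, dist_eq_norm (_ : H), Real.dist_eq]
    refine (abs_norm_sub_norm_le _ _).trans_lt (lt_of_eq_of_lt ?_ (hKV (x v) (v (0 : Fin 2)).2))
    congr 1
    simp only [add_apply, smul_apply,
      ContinuousLinearMap.id_apply, x, y]
    abel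
  choose φ hφ using happrox
  refine ⟨φ, Metric.tendstoUniformly_iff.2 fun ε hε => ?_⟩
  filter_upwards [(tendsto_one_div_add_atTop_nhds_zero_nat (𝕜 := ℝ)).eventually_lt_const hε]
    with k hk v
  exact (hφ k v).trans hk

end QuantifierFree

end HilbertLogic

theorem mainTheorem2 {H : Type*} [NormedAddCommGroup H] [InnerProductSpace ℂ H] [CompleteSpace H]
    (hH : ¬ FiniteDimensional ℂ H) (T : H →L[ℂ] H) :
    HilbertLogic.IsDefinable (T : H → H) ↔
      ∃ (lam : ℂ) (K : H →L[ℂ] H), IsCompactOperator K ∧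
        T = lam • ContinuousLinearMap.id ℂ H + K := by
  constructor
  · intro hT
    refine HilbertLogic.exists_eq_smul_id_add_compact hH T fun ε hε => ?_
    -- Halving `ε` absorbs the factor 2 lost in passing to scalars.
    obtain ⟨V, hV, hcomm⟩ := hT.exists_norm_commutator_le (half_pos hε)
    obtain ⟨W, c, hW, hc⟩ := HilbertLogic.exists_norm_sub_smul_le hH T V hcomm
    exact ⟨W, c, hW, fun y hy => (hc y hy).trans_eq (by ring)⟩
  · rintro ⟨l, K, hK, rfl⟩
    exact HilbertLogic.isDefinable_smul_id_add l hK
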